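/- All graphs are finite, simple and undirected. For a graph $G$ with adjacency matrix $A$ and $t\ge 0$ put $U(t)=\exp(\mathrm{i}tA)$; $G$ admits perfect state transfer between two vertices $a$ and $b$ if $|U(t)_{b,a}|=1$ for some $t\ge 0$. Theorem. Let $Y_1$ and $Y_2$ be connected graphs, let $a$ be a vertex of $Y_1$ and $b$ a vertex of $Y_2$, and let $Z$ be the graph obtained from the disjoint union of $Y_1$ and $Y_2$ by adding a single edge joining $a$ and $b$. If $Z$ admits perfect state transfer between $a$ and $b$, then $Y_1$ and $Y_2$ have exactly one vertex each, and hence $Z$ is the path $P_2$ on two vertices. -/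

import Mathlib

/-- The continuous-time quantum walk on a finite simple graph `G` at time `t`: the matrix
`U(t) = exp(i t A)`, where `A` is the (complex) `0`-`1` adjacency matrix of `G`. -/
noncomputable def quantumWalk {V : Type*} [Fintype V] (G : SimpleGraph V) (t : ℝ) :
    Matrix V V ℂ :=
  open scoped Classical in
  NormedSpace.exp ((Complex.I * (t : ℂ)) • G.adjMatrix ℂ)

/-- `G` admits perfect state transfer between `a` and `b` at time `t`: `|⟨b| U(t) |a⟩| = 1`. -/
def PerfectStateTransferAt {V : Type*} [Fintype V] (G : SimpleGraph V) (a b : V) (t : ℝ) :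
    Prop :=
  ‖quantumWalk G t b a‖ = 1

/-- `G` admits perfect state transfer between `a` and `b` (at some time `t ≥ 0`). -/
def PerfectStateTransfer {V : Type*} [Fintype V] (G : SimpleGraph V) (a b : V) : Prop :=
  ∃ t : ℝ, 0 ≤ t ∧ PerfectStateTransferAt G a b t

/-- The graph obtained from the disjoint union of `Y₁` and `Y₂` by adding a single edge, which
joins the vertex `a` of `Y₁` to the vertex `b` of `Y₂`. -/
def bridgeJoin {V₁ V₂ : Type*} (Y₁ : SimpleGraph V₁) (Y₂ : SimpleGraph V₂) (a : V₁) (b : V₂) :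
    SimpleGraph (V₁ ⊕ V₂) :=
  (Y₁ ⊕g Y₂) ⊔ SimpleGraph.edge (Sum.inl a) (Sum.inr b)

open scoped InnerProductSpace
open Matrix

/-! Let `T` be the adjacency operator of `Y₁`, `e` the unit vector at `a`, `R` the projection onto
`e`. An eigenvector of `T + σR` (`σ = ±1`) not vanishing at `a`, extended by zero to `Y₂`, is an
eigenvector of `Z` up to a multiple of `e_b - σ e_a`. State transfer turns it into a true
eigenvector and forces its eigenvalue to have phase `σγ`. On the cyclic subspace generated by `e`,
the eigenvalues of `T + R` strictly exceed those of `T - R`, and the gaps sum to 2. Opposite phases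
make the gaps rational, hence positive integers, so the dimension is at most 2. Dimension 2 fails by
parity, using traces of squares and cubes. So `e` is an eigenvector of `T`; as `T` has zero
diagonal, `T e = 0` and `a` is isolated in `Y₁`. Since the walk commutes with adjacency, `b` is
isolated in `Y₂`; connectedness finishes. -/

/-- Strict Weyl monotonicity for a positive rank-one perturbation along a vector `e` to which no
eigenvector of `M` is orthogonal. -/
theorem eigenvalues_lt_eigenvalues_of_rankOne_add {n : ℕ} {E : Type*} [NormedAddCommGroup E]
    [InnerProductSpace ℝ E] [FiniteDimensional ℝ E] {M P : E →ₗ[ℝ] E} (hM : M.IsSymmetric)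
    (hP : P.IsSymmetric) (hn : Module.finrank ℝ E = n) {e : E} {c : ℝ} (hc : 0 < c)
    (hPM : ∀ x, P x = M x + (c * ⟪e, x⟫_ℝ) • e)
    (he : ∀ (μ : ℝ) (x : E), M x = μ • x → ⟪e, x⟫_ℝ = 0 → x = 0) (j : Fin n) :
    hM.eigenvalues hn j < hP.eigenvalues hn j := by
  by_contra! hj
  set p := hP.eigenvectorBasis hn
  set m := hM.eigenvectorBasis hn
  set α := hP.eigenvalues hn
  set β := hM.eigenvalues hn
  have inner_sum (Q : E →ₗ[ℝ] E) (q : OrthonormalBasis (Fin n) ℝ E) (ν : Fin n → ℝ)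
      (hq : ∀ i x, ⟪q i, Q x⟫_ℝ = ν i * ⟪q i, x⟫_ℝ) (x : E) :
      ⟪x, Q x⟫_ℝ = ∑ i, ν i * ⟪q i, x⟫_ℝ ^ 2 := by
    rw [← q.sum_inner_mul_inner]
    refine Finset.sum_congr rfl fun i _ ↦ ?_
    rw [hq, real_inner_comm]; ring
  have hp i x : ⟪p i, P x⟫_ℝ = α i * ⟪p i, x⟫_ℝ := by
    rw [← hP, hP.apply_eigenvectorBasis, inner_smul_left]; simp [p, α]
  have hm i x : ⟪m i, M x⟫_ℝ = β i * ⟪m i, x⟫_ℝ := by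
    rw [← hM, hM.apply_eigenvectorBasis, inner_smul_left]; simp [m, β]
  -- Only `n - 1` conditions, so some `w ≠ 0` is orthogonal to `p i` for `i < j` and `m i` for `i >
  -- j`. Eigenvalues decrease, so the Rayleigh quotient at `w` is at most `α j` for `P` and at least
  -- `β j` for `M`.
  let Φ : E →ₗ[ℝ] ({i : Fin n // i ≠ j} → ℝ) :=
    LinearMap.pi fun i ↦ innerₛₗ ℝ (if i.1 < j then p i else m i)
  have hΦ : LinearMap.ker Φ ≠ ⊥ := by
    apply LinearMap.ker_ne_bot_of_finrank_lt
    have := j.pos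
    simp only [Module.finrank_fintype_fun_eq_card, Fintype.card_subtype_compl, hn,
      Fintype.card_fin, Fintype.card_unique]
    omega
  obtain ⟨w, hw, hw0⟩ := (Submodule.ne_bot_iff _).1 hΦ
  have hw' (i : Fin n) (hi : i ≠ j) : ⟪if i < j then p i else m i, w⟫_ℝ = 0 :=
    congrFun hw ⟨i, hi⟩
  have norm_sum (q : OrthonormalBasis (Fin n) ℝ E) : ⟪w, w⟫_ℝ = ∑ i, ⟪q i, w⟫_ℝ ^ 2 := by
    rw [← q.sum_inner_mul_inner]
    refine Finset.sum_congr rfl fun i _ ↦ ?_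
    rw [real_inner_comm, sq]
  have h1 : ⟪w, P w⟫_ℝ ≤ α j * ⟪w, w⟫_ℝ := by
    rw [inner_sum P p α hp, norm_sum p, Finset.mul_sum]
    refine Finset.sum_le_sum fun i _ ↦ ?_
    rcases lt_or_ge i j with hi | hi
    · have := hw' i hi.ne
      rw [if_pos hi] at this
      simp [this]
    · exact mul_le_mul_of_nonneg_right (hP.eigenvalues_antitone hn hi) (sq_nonneg _)
  have key i : 0 ≤ (β i - β j) * ⟪m i, w⟫_ℝ ^ 2 := by
    rcases le_or_gt i j with hi | hi
    · exact mul_nonneg (sub_nonneg.2 (hM.eigenvalues_antitone hn hi)) (sq_nonneg _)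
    · have := hw' i hi.ne'
      rw [if_neg hi.not_gt] at this
      simp [this]
  have h2 : ⟪w, M w⟫_ℝ - β j * ⟪w, w⟫_ℝ = ∑ i, (β i - β j) * ⟪m i, w⟫_ℝ ^ 2 := by
    rw [inner_sum M m β hm, norm_sum m, Finset.mul_sum, ← Finset.sum_sub_distrib]
    exact Finset.sum_congr rfl fun i _ ↦ by ring
  have h3 : ⟪w, P w⟫_ℝ = ⟪w, M w⟫_ℝ + c * ⟪e, w⟫_ℝ ^ 2 := by
    rw [hPM, inner_add_right, inner_smul_right, real_inner_comm e w]; ring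
  have h4 : 0 ≤ ∑ i, (β i - β j) * ⟪m i, w⟫_ℝ ^ 2 := Finset.sum_nonneg fun i _ ↦ key i
  have h5 : 0 ≤ c * ⟪e, w⟫_ℝ ^ 2 := by positivity
  have h6 : α j * ⟪w, w⟫_ℝ ≤ β j * ⟪w, w⟫_ℝ :=
    mul_le_mul_of_nonneg_right hj real_inner_self_nonneg
  have h7 : ∑ i, (β i - β j) * ⟪m i, w⟫_ℝ ^ 2 = 0 := by linarith
  have h8 : c * ⟪e, w⟫_ℝ ^ 2 = 0 := by linarith
  -- Equality throughout makes `w` a `β j`-eigenvector of `M` orthogonal to `e`.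
  refine hw0 (he (β j) w ?_ (by simpa [hc.ne'] using h8))
  refine m.repr.injective (PiLp.ext fun i ↦ ?_)
  rw [m.repr_apply_apply, m.repr_apply_apply, hm, inner_smul_right]
  have := (Finset.sum_eq_zero_iff_of_nonneg fun i _ ↦ key i).1 h7 i (Finset.mem_univ i)
  rcases mul_eq_zero.1 this with h | h
  · rw [sub_eq_zero.1 h]
  · simp [pow_eq_zero_iff two_ne_zero |>.1 h]

/-! ### Arithmetic of the phases -/

theorem Real.one_le_of_isIntegral_of_rat {x : ℝ} (hx : IsIntegral ℤ x) (q : ℚ) (hq : x = q)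
    (h0 : 0 < x) : 1 ≤ x := by
  subst hq
  have : IsIntegral ℤ q := by
    rwa [← isIntegral_algebraMap_iff (B := ℝ) (algebraMap ℚ ℝ).injective]
  obtain ⟨z, rfl⟩ := IsIntegrallyClosed.isIntegral_iff.1 this
  simp only [eq_intCast, Rat.cast_intCast] at h0 ⊢
  exact_mod_cast h0

theorem exists_int_mul_pi_of_exp_eq {x y : ℝ} (h : Complex.exp (Complex.I * x) =
    Complex.exp (Complex.I * y)) : ∃ k : ℤ, x - y = 2 * k * Real.pi := by
  obtain ⟨k, hk⟩ := Complex.exp_eq_exp_iff_exists_int.1 h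
  refine ⟨k, ?_⟩
  have : Complex.I * (x : ℂ) = Complex.I * ((y : ℂ) + 2 * k * Real.pi) := by rw [hk]; ring
  have := mul_left_cancel₀ Complex.I_ne_zero this
  have : x = y + 2 * k * Real.pi := by exact_mod_cast this
  linarith

theorem exists_odd_mul_pi_of_exp_eq_neg {x y : ℝ} (h : Complex.exp (Complex.I * x) =
    -Complex.exp (Complex.I * y)) : ∃ k : ℤ, x - y = (2 * k + 1) * Real.pi := by
  have : Complex.exp (Complex.I * x) = Complex.exp (Complex.I * ((y + Real.pi : ℝ) : ℂ)) := by
    push_cast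
    rw [h, mul_add, Complex.exp_add, mul_comm Complex.I (Real.pi : ℂ), Complex.exp_pi_mul_I]
    ring
  obtain ⟨k, hk⟩ := exists_int_mul_pi_of_exp_eq this
  exact ⟨k, by linarith⟩

/-- Two interlacing families of algebraic integers whose phases at time `t` are opposite and whose
first three power sums differ as prescribed have at most one member each. -/
theorem card_le_one_of_phases {n : ℕ} {α β : Fin n → ℝ} (hlt : ∀ j, β j < α j)
    (hα : ∀ j, IsIntegral ℤ (α j)) (hβ : ∀ j, IsIntegral ℤ (β j)) {γ : ℂ} {t : ℝ}
    (eα : ∀ j, Complex.exp (Complex.I * t * α j) = γ)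
    (eβ : ∀ j, Complex.exp (Complex.I * t * β j) = -γ) {w : ℕ}
    (h1 : ∑ j, α j - ∑ j, β j = 2) (h2 : ∑ j, α j ^ 2 - ∑ j, β j ^ 2 = 0)
    (h3 : ∑ j, α j ^ 3 - ∑ j, β j ^ 3 = 6 * w + 2) : n ≤ 1 := by
  have hgap (j) : ∃ k : ℤ, t * (α j - β j) = (2 * k + 1) * Real.pi := by
    rw [mul_sub]
    apply exists_odd_mul_pi_of_exp_eq_neg
    have a := eα j; have b := eβ j
    rw [mul_assoc] at a b
    push_cast
    rw [a, b, neg_neg]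
  choose k hk using hgap
  set N : ℤ := ∑ j, (2 * k j + 1) with hN
  -- Summing the gaps removes the eigenvalues, so `t` is a rational multiple of `π` and each gap is
  -- rational.
  have ht : 2 * t = N * Real.pi := by
    calc 2 * t = t * (∑ j, α j - ∑ j, β j) := by rw [h1]; ring
      _ = ∑ j, t * (α j - β j) := by rw [← Finset.sum_sub_distrib, Finset.mul_sum]
      _ = N * Real.pi := by
        rw [hN]; push_cast; rw [Finset.sum_mul]; exact Finset.sum_congr rfl fun j _ ↦ hk j
  rcases Nat.eq_zero_or_pos n with rfl | hn
  · exact zero_le_one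
  have hpi := Real.pi_pos
  have hN0 : (N : ℝ) ≠ 0 := by
    intro h
    have ht0 : t = 0 := by rw [h] at ht; linarith
    have := hk ⟨0, hn⟩
    rw [ht0, zero_mul, eq_comm, mul_eq_zero, or_iff_left hpi.ne'] at this
    have : 2 * k ⟨0, hn⟩ + 1 = 0 := by exact_mod_cast this
    omega
  have hgap' (j) : N * (α j - β j) = 2 * (2 * k j + 1) := by
    have : N * (α j - β j) * Real.pi = 2 * (2 * k j + 1) * Real.pi := by
      linear_combination 2 * hk j - (α j - β j) * ht
    exact mul_right_cancel₀ hpi.ne' this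
  have hone (j) : 1 ≤ α j - β j := by
    refine Real.one_le_of_isIntegral_of_rat ((hα j).sub (hβ j)) (2 * (2 * k j + 1) / N) ?_
      (sub_pos.2 (hlt j))
    push_cast
    rw [eq_div_iff hN0, ← hgap', mul_comm]
  have hn2 : n ≤ 2 := by
    have : ∑ _j : Fin n, (1 : ℝ) ≤ ∑ j, (α j - β j) := Finset.sum_le_sum fun j _ ↦ hone j
    rw [Finset.sum_sub_distrib, h1] at this
    simp only [Finset.sum_const, Finset.card_univ, Fintype.card_fin, nsmul_eq_mul, mul_one] at this
    exact_mod_cast this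
  by_contra! hn1
  obtain rfl : n = 2 := le_antisymm hn2 hn1
  simp only [Fin.sum_univ_two] at h1 h2 h3
  have g0 := hone 0
  have g1 := hone 1
  have b0 : β 0 = α 0 - 1 := by linarith
  have b1 : β 1 = α 1 - 1 := by linarith
  rw [b0, b1] at h2 h3
  have s1 : α 0 + α 1 = 1 := by linarith
  -- With both gaps 1, squares give `α 0 + α 1 = 1`, and cubes then give the discriminant.
  have hD : (α 0 - α 1) ^ 2 = 4 * w + 1 := by
    linear_combination (2 / 3) * h3 + 2 * s1 - (α 0 + α 1 + 1) * s1
  obtain ⟨l, hl⟩ : ∃ l : ℤ, t * α 0 - t * α 1 = 2 * l * Real.pi := by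
    apply exists_int_mul_pi_of_exp_eq
    push_cast
    rw [← mul_assoc, ← mul_assoc, eα, eα]
  have hl' : N * (α 0 - α 1) = 4 * l := by
    have : N * (α 0 - α 1) * Real.pi = 4 * l * Real.pi := by
      linear_combination 2 * hl - (α 0 - α 1) * ht
    exact mul_right_cancel₀ hpi.ne' this
  have hN2 : (N : ℝ) = 2 * (2 * k 0 + 1) := by
    rw [← hgap', b0]; ring
  rw [hN2] at hl'
  have hsq : ((2 * k 0 + 1 : ℝ)) ^ 2 * (4 * w + 1) = (2 * l) ^ 2 := by
    rw [← hD]; linear_combination (1 / 4) * ((2 * (2 * k 0 + 1)) * (α 0 - α 1) + 4 * l) * hl'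
  -- The left side is odd, the right side even.
  have hsq' : (2 * k 0 + 1) ^ 2 * (4 * (w : ℤ) + 1) = (2 * l) ^ 2 := by exact_mod_cast hsq
  have e1 : (2 * k 0 + 1) ^ 2 * (4 * (w : ℤ) + 1) =
      2 * ((2 * k 0 ^ 2 + 2 * k 0) * (4 * w + 1) + 2 * w) + 1 := by ring
  have e2 : (2 * l) ^ 2 = 2 * (2 * l ^ 2) := by ring
  omega

/-! ### Eigenvectors and the walk matrix -/

theorem Matrix.exp_mulVec_of_mulVec_eq {n : Type*} [Fintype n] [DecidableEq n] {M : Matrix n n ℂ}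
    {v : n → ℂ} {c : ℂ} (h : M *ᵥ v = c • v) : NormedSpace.exp M *ᵥ v = Complex.exp c • v := by
  let _ : NormedRing (Matrix n n ℂ) := Matrix.linftyOpNormedRing
  let _ : NormedAlgebra ℂ (Matrix n n ℂ) := Matrix.linftyOpNormedAlgebra
  have hpow (k : ℕ) : M ^ k *ᵥ v = c ^ k • v := by
    induction k with
    | zero => simp
    | succ k ih => rw [pow_succ, ← mulVec_mulVec, h, mulVec_smul, ih, smul_smul, pow_succ']
  have h1 := (NormedSpace.exp_series_hasSum_exp' (𝕂 := ℂ) M).map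
    (⟨⟨fun N : Matrix n n ℂ ↦ N *ᵥ v, by simp⟩, fun N N' ↦ add_mulVec N N' v⟩ :
      Matrix n n ℂ →+ (n → ℂ)) (by
        change Continuous fun N : Matrix n n ℂ ↦ N *ᵥ v
        fun_prop)
  have h2 := (NormedSpace.exp_series_hasSum_exp' (𝕂 := ℂ) c).smul_const v
  rw [Complex.exp_eq_exp_ℂ]
  refine h1.unique (h2.congr_fun ?_)
  intro k
  simp [smul_mulVec, hpow, smul_smul]

/-- Columns of a unitary matrix have norm 1, so one unimodular entry exhausts its column. -/
theorem Matrix.apply_eq_zero_of_norm_apply_eq_one {n : Type*} [Fintype n] [DecidableEq n]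
    {U : Matrix n n ℂ} (hU : Uᴴ * U = 1) {a b : n} (h : ‖U b a‖ = 1) {x : n} (hx : x ≠ b) :
    U x a = 0 := by
  have h1 : ∑ y, ‖U y a‖ ^ 2 = 1 := by
    have := congrFun (congrFun hU a) a
    rw [mul_apply, one_apply_eq] at this
    simp only [conjTranspose_apply, ← starRingEnd_apply, RCLike.conj_mul] at this
    exact RCLike.ofReal_injective (K := ℂ) (by push_cast; exact this)
  rw [← Finset.add_sum_erase _ _ (Finset.mem_univ b), h, one_pow, add_eq_left,
    Finset.sum_eq_zero_iff_of_nonneg fun _ _ ↦ sq_nonneg _] at h1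
  simpa using h1 x (by simp [hx])

theorem Matrix.mulVec_single_one_of_norm_apply_eq_one {n : Type*} [Fintype n] [DecidableEq n]
    {U : Matrix n n ℂ} (hU : Uᴴ * U = 1) {a b : n} (h : ‖U b a‖ = 1) :
    U *ᵥ Pi.single a 1 = U b a • Pi.single b 1 := by
  ext x
  rcases eq_or_ne x b with rfl | hx
  · simp
  · simp [hx, apply_eq_zero_of_norm_apply_eq_one hU h hx]

/-- If `exp (s A)` exchanges `a` and `b` up to a phase `γ`, then a vector vanishing at `b` that is an
eigenvector of `A` up to a multiple of `e_b - σ e_a` has its eigenvalue's phase equal to `σ γ`. -/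
theorem exp_eq_of_mulVec_eq {n : Type*} [Fintype n] [DecidableEq n] {A : Matrix n n ℂ} {s : ℂ}
    (hsymm : Aᵀ = A) {a b : n} {γ : ℂ} (hγ : γ ≠ 0)
    (ha : NormedSpace.exp (s • A) *ᵥ Pi.single a 1 = γ • Pi.single b 1)
    (hb : NormedSpace.exp (s • A) *ᵥ Pi.single b 1 = γ • Pi.single a 1)
    {u : n → ℂ} {μ σ : ℂ} (hσ : σ * σ = 1) (hua : u a ≠ 0) (hub : u b = 0)
    (hu : A *ᵥ u = μ • u + u a • (Pi.single b 1 - σ • Pi.single a 1)) :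
    Complex.exp (s * μ) = σ * γ := by
  set U := NormedSpace.exp (s • A) with hU
  have hUsymm : Uᵀ = U := by rw [hU, ← exp_transpose, transpose_smul, hsymm]
  have hcomm : A * U = U * A := (((Commute.refl A).smul_right s).exp_right).eq
  have hUb x : U x b = (γ • Pi.single a 1 : n → ℂ) x := by rw [← hb]; simp
  have hUa x : U x a = (γ • Pi.single b 1 : n → ℂ) x := by rw [← ha]; simp
  have hrow (i j : n) (hij : ∀ x, U x i = (γ • Pi.single j 1 : n → ℂ) x) (y : n → ℂ) :
      (U *ᵥ y) i = γ * y j := by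
    rw [mulVec, dotProduct, Finset.sum_eq_single j]
    · rw [← hUsymm, transpose_apply, hij]; simp
    · intro x _ hx
      rw [← hUsymm, transpose_apply, hij]; simp [hx]
    · simp
  -- `U` swaps `e_a` and `e_b` up to `γ`, so in this combination the error terms of `u` and `U u`
  -- cancel because `σ² = 1`.
  set v := γ • u + σ • U *ᵥ u with hv
  have hAv : A *ᵥ v = μ • v := by
    have : A *ᵥ (U *ᵥ u) = μ • U *ᵥ u + (u a * γ) • (Pi.single a 1 - σ • Pi.single b 1) := by
      rw [mulVec_mulVec, hcomm, ← mulVec_mulVec, hu, mulVec_add, mulVec_smul, mulVec_smul,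
        mulVec_sub, mulVec_smul, ha, hb]
      module
    rw [hv, mulVec_add, mulVec_smul, mulVec_smul, this, hu]
    linear_combination (norm := module) (-(u a * γ) * hσ) • (Pi.single b 1 : n → ℂ)
  have hva : v a = γ * u a := by simp [hv, hrow a b hUa, hub]
  have hvb : v b = σ * (γ * u a) := by simp [hv, hrow b a hUb, hub]
  have hUv : U *ᵥ v = Complex.exp (s * μ) • v :=
    exp_mulVec_of_mulVec_eq (by rw [smul_mulVec, hAv, smul_smul])
  have := congrFun hUv b
  rw [hrow b a hUb, Pi.smul_apply, hva, hvb, smul_eq_mul] at this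
  have h3 : γ * u a ≠ 0 := mul_ne_zero hγ hua
  have h4 : (γ * u a) * (Complex.exp (s * μ) * σ) = (γ * u a) * γ := by linear_combination -this
  have h5 := mul_left_cancel₀ h3 h4
  linear_combination σ * h5 - Complex.exp (s * μ) * hσ

theorem Matrix.isIntegral_of_mulVec_eq {n : Type*} [Fintype n] [DecidableEq n] {M : Matrix n n ℤ}
    {v : n → ℝ} (hv : v ≠ 0) {μ : ℝ} (h : M.map (Int.castRingHom ℝ) *ᵥ v = μ • v) :
    IsIntegral ℤ μ := by
  refine ⟨M.charpoly, M.charpoly_monic, ?_⟩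
  rw [← Polynomial.eval_map, algebraMap_int_eq, ← charpoly_map, eval_charpoly]
  refine exists_mulVec_eq_zero_iff.1 ⟨v, hv, ?_⟩
  rw [sub_mulVec, h, sub_eq_zero]
  ext x
  simp [mulVec_diagonal]

/-! ### Rank-one perturbations on the cyclic subspace -/

section Trace
variable {E : Type*} [NormedAddCommGroup E] [InnerProductSpace ℝ E]

/-- The operator `x ↦ ⟪e, x⟫ e`. -/
noncomputable def rankOneProj (e : E) : E →ₗ[ℝ] E := (InnerProductSpace.rankOne ℝ e e).toLinearMap

theorem rankOneProj_apply (e x : E) : rankOneProj e x = ⟪e, x⟫_ℝ • e := by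
  simp [rankOneProj]

theorem isSymmetric_rankOneProj (e : E) : (rankOneProj e).IsSymmetric := fun x y ↦ by
  simp only [rankOneProj_apply, inner_smul_left, inner_smul_right, real_inner_comm]
  simp [mul_comm]

variable [FiniteDimensional ℝ E]

theorem LinearMap.IsSymmetric.trace_pow_eq_sum_eigenvalues {T : E →ₗ[ℝ] E} (hT : T.IsSymmetric)
    {n : ℕ} (hn : Module.finrank ℝ E = n) (k : ℕ) :
    LinearMap.trace ℝ E (T ^ k) = ∑ i, hT.eigenvalues hn i ^ k := by
  rw [LinearMap.trace_eq_sum_inner _ (hT.eigenvectorBasis hn)]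
  refine Finset.sum_congr rfl fun i _ ↦ ?_
  have : (T ^ k) (hT.eigenvectorBasis hn i) =
      hT.eigenvalues hn i ^ k • hT.eigenvectorBasis hn i := by
    simpa using (hT.hasEigenvector_eigenvectorBasis hn i).pow_apply k
  rw [this, inner_smul_right]
  simp

theorem trace_mul_rankOneProj (L : E →ₗ[ℝ] E) (e : E) :
    LinearMap.trace ℝ E (L * rankOneProj e) = ⟪e, L e⟫_ℝ := by
  have : L * rankOneProj e = (InnerProductSpace.rankOne ℝ (L e) e).toLinearMap := by
    ext x
    simp [rankOneProj_apply]
  rw [this, InnerProductSpace.trace_rankOne]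

theorem finrank_le_one_of_phases {T : E →ₗ[ℝ] E} (hT : T.IsSymmetric) {e : E} (he : ‖e‖ = 1)
    {w : ℕ} (h1 : ⟪e, T e⟫_ℝ = 0) (h2 : ⟪T e, T e⟫_ℝ = w)
    (hcyc : ∀ (μ : ℝ) (x : E), T x = μ • x → ⟪e, x⟫_ℝ = 0 → x = 0) {γ : ℂ} {t : ℝ}
    (hphase : ∀ (σ μ : ℝ) (x : E), σ * σ = 1 → x ≠ 0 → T x + (σ * ⟪e, x⟫_ℝ) • e = μ • x →
      IsIntegral ℤ μ ∧ Complex.exp (Complex.I * t * μ) = σ * γ) :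
    Module.finrank ℝ E ≤ 1 := by
  set R := rankOneProj e with hR
  have hRs : R.IsSymmetric := isSymmetric_rankOneProj e
  have hP : (T + R).IsSymmetric := hT.add hRs
  have hM : (T - R).IsSymmetric := hT.sub hRs
  have hee : ⟪e, e⟫_ℝ = 1 := by rw [real_inner_self_eq_norm_sq, he, one_pow]
  have hRR : R * R = R := by
    ext x
    simp [hR, rankOneProj_apply, he]
  have hlt := eigenvalues_lt_eigenvalues_of_rankOne_add hM hP rfl (e := e) two_pos
    (fun x ↦ by
      simp only [LinearMap.add_apply, LinearMap.sub_apply, hR, rankOneProj_apply]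
      module)
    (fun μ x hx hex ↦ hcyc μ x (by simpa [hR, rankOneProj_apply, hex] using hx) hex)
  have hα i := hphase 1 (hP.eigenvalues rfl i) (hP.eigenvectorBasis rfl i) (by ring)
    (hP.hasEigenvector_eigenvectorBasis rfl i).2 (by
      have := hP.apply_eigenvectorBasis rfl i
      simpa [hR, rankOneProj_apply] using this)
  have hβ i := hphase (-1) (hM.eigenvalues rfl i) (hM.eigenvectorBasis rfl i) (by ring)
    (hM.hasEigenvector_eigenvectorBasis rfl i).2 (by
      have := hM.apply_eigenvectorBasis rfl i
      simpa [hR, rankOneProj_apply, sub_eq_add_neg] using this)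
  have tR : LinearMap.trace ℝ E R = 1 := by
    rw [← one_mul R, hR, trace_mul_rankOneProj]; simpa using hee
  have tTR : LinearMap.trace ℝ E (T * R) = 0 := by rw [hR, trace_mul_rankOneProj, h1]
  have tTTR : LinearMap.trace ℝ E (T * T * R) = w := by
    rw [hR, trace_mul_rankOneProj, ← h2, hT]; rfl
  have tRTT : LinearMap.trace ℝ E (R * (T * T)) = w := by rw [LinearMap.trace_mul_comm, tTTR]
  have tTRT : LinearMap.trace ℝ E (T * R * T) = w := by
    rw [LinearMap.trace_mul_comm, ← mul_assoc, tTTR]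
  refine card_le_one_of_phases (w := w) (γ := γ) (t := t) hlt (fun i ↦ (hα i).1)
    (fun i ↦ (hβ i).1) (fun i ↦ by simpa using (hα i).2) (fun i ↦ by simpa using (hβ i).2) ?_ ?_ ?_
  · have hP1 := hP.trace_pow_eq_sum_eigenvalues rfl 1
    have hM1 := hM.trace_pow_eq_sum_eigenvalues rfl 1
    simp only [pow_one, map_add, map_sub, tR] at hP1 hM1
    rw [← hP1, ← hM1]; ring
  · rw [← hP.trace_pow_eq_sum_eigenvalues, ← hM.trace_pow_eq_sum_eigenvalues, ← map_sub]
    have : (T + R) ^ 2 - (T - R) ^ 2 = T * R + T * R + (R * T + R * T) := by noncomm_ring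
    rw [this, map_add, map_add, map_add, LinearMap.trace_mul_comm ℝ R T, tTR]
    norm_num
  · rw [← hP.trace_pow_eq_sum_eigenvalues, ← hM.trace_pow_eq_sum_eigenvalues, ← map_sub]
    have : (T + R) ^ 3 - (T - R) ^ 3 =
        (2 : ℝ) • (T * T * R + T * R * T + R * (T * T) + R * R * R) := by
      simp only [two_smul]; noncomm_ring
    rw [this, hRR, hRR, map_smul, map_add, map_add, map_add, tTTR, tTRT, tRTT, tR, smul_eq_mul]
    ring

theorem map_eq_zero_of_phases {T : E →ₗ[ℝ] E} (hT : T.IsSymmetric) {e : E} (he : ‖e‖ = 1)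
    {w : ℕ} (h1 : ⟪e, T e⟫_ℝ = 0) (h2 : ⟪T e, T e⟫_ℝ = w) {γ : ℂ} {t : ℝ}
    (hphase : ∀ (σ μ : ℝ) (x : E), σ * σ = 1 → ⟪e, x⟫_ℝ ≠ 0 →
      T x + (σ * ⟪e, x⟫_ℝ) • e = μ • x →
      IsIntegral ℤ μ ∧ Complex.exp (Complex.I * t * μ) = σ * γ) :
    T e = 0 := by
  -- Inside `W` no eigenvector of `T` is orthogonal to `e`: it would be orthogonal to every `T ^ k
  -- e`. This gives the strict inequalities.
  let W : Submodule ℝ E := Submodule.span ℝ (Set.range fun k : ℕ ↦ (T ^ k) e)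
  have heW : e ∈ W := Submodule.subset_span ⟨0, by simp⟩
  have hTW : ∀ x ∈ W, T x ∈ W := by
    intro x hx
    induction hx using Submodule.span_induction with
    | mem x hx =>
      obtain ⟨k, rfl⟩ := hx
      exact Submodule.subset_span ⟨k + 1, by simp [pow_succ']⟩
    | zero => simp
    | add x y _ _ hx hy => rw [map_add]; exact W.add_mem hx hy
    | smul c x _ hx => rw [map_smul]; exact W.smul_mem c hx
  have hcyc (μ : ℝ) (x : E) (hxW : x ∈ W) (hx : T x = μ • x) (hex : ⟪e, x⟫_ℝ = 0) : x = 0 := by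
    have key : ∀ y ∈ W, ⟪y, x⟫_ℝ = 0 := by
      intro y hy
      induction hy using Submodule.span_induction with
      | mem y hy =>
        obtain ⟨k, rfl⟩ := hy
        dsimp only
        induction k with
        | zero => simpa using hex
        | succ k ih =>
          rw [pow_succ', Module.End.mul_apply, hT, hx, inner_smul_right, ih, mul_zero]
      | zero => simp
      | add y z _ _ hy hz => rw [inner_add_left, hy, hz, add_zero]
      | smul c y _ hy => rw [inner_smul_left, hy, mul_zero]
    exact inner_self_eq_zero.1 (key x hxW)
  have hW : Module.finrank ℝ W ≤ 1 := by
    refine finrank_le_one_of_phases (T := T.restrict hTW) (hT.restrict_invariant hTW)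
      (e := ⟨e, heW⟩) (w := w) (γ := γ) (t := t) he h1 h2 ?_ ?_
    · rintro μ ⟨x, hx⟩ hTx hex
      exact Subtype.ext (hcyc μ x hx (congrArg Subtype.val hTx) hex)
    · rintro σ μ ⟨x, hx⟩ hσ hx0 hTx
      have hTx' : T x + (σ * ⟪e, x⟫_ℝ) • e = μ • x := congrArg Subtype.val hTx
      refine hphase σ μ x hσ (fun hex ↦ hx0 (Subtype.ext (hcyc μ x hx ?_ hex))) hTx'
      simpa [hex] using hTx'
  have he0 : e ≠ 0 := by rintro rfl; simp at he
  obtain ⟨v, hv⟩ := finrank_le_one_iff.1 hW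
  obtain ⟨c, hc⟩ := hv ⟨e, heW⟩
  obtain ⟨d, hd⟩ := hv ⟨T e, hTW e heW⟩
  replace hc : c • (v : E) = e := congrArg Subtype.val hc
  replace hd : d • (v : E) = T e := congrArg Subtype.val hd
  have hc0 : c ≠ 0 := by rintro rfl; simp at hc; exact he0 hc.symm
  have hTe : T e = (d / c) • e := by
    rw [← hd, ← hc, smul_smul, div_mul_cancel₀ _ hc0]
  rw [hTe, inner_smul_right, real_inner_self_eq_norm_sq, he] at h1
  rw [hTe, show d / c = 0 by simpa using h1, zero_smul]
end Trace

theorem PerfectStateTransferAt.exists_phase {V : Type*} [Fintype V] [DecidableEq V]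
    {G : SimpleGraph V} [DecidableRel G.Adj] {a b : V} {t : ℝ}
    (h : PerfectStateTransferAt G a b t) :
    ∃ γ : ℂ, γ ≠ 0 ∧
      NormedSpace.exp ((Complex.I * t) • G.adjMatrix ℂ) *ᵥ Pi.single a 1 = γ • Pi.single b 1 ∧
      NormedSpace.exp ((Complex.I * t) • G.adjMatrix ℂ) *ᵥ Pi.single b 1 = γ • Pi.single a 1 := by
  set U := NormedSpace.exp ((Complex.I * t) • G.adjMatrix ℂ) with hU
  have h1 : ‖U b a‖ = 1 := by
    rw [← h, quantumWalk, hU]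
    congr!
  have hsymm : Uᵀ = U := by
    rw [hU, ← exp_transpose, transpose_smul, SimpleGraph.transpose_adjMatrix]
  have hunit : Uᴴ * U = 1 := by
    have hstar : Uᴴ = NormedSpace.exp (-((Complex.I * t) • G.adjMatrix ℂ)) := by
      rw [hU, ← exp_conjTranspose, conjTranspose_smul,
        (SimpleGraph.isHermitian_adjMatrix ..).eq]
      simp
    rw [hstar, hU, ← exp_add_of_commute _ _
      (Commute.refl ((Complex.I * t) • G.adjMatrix ℂ)).neg_left, neg_add_cancel,
      NormedSpace.exp_zero]
  have h2 : U a b = U b a := congrFun (congrFun hsymm b) a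
  refine ⟨U b a, fun h0 ↦ by simp [h0] at h1, mulVec_single_one_of_norm_apply_eq_one hunit h1, ?_⟩
  rw [← h2]
  exact mulVec_single_one_of_norm_apply_eq_one hunit (h2 ▸ h1)

/-! ### Application to the bridge -/

section bridgeJoin
variable {V₁ V₂ : Type*} {Y₁ : SimpleGraph V₁} {Y₂ : SimpleGraph V₂} {a : V₁} {b : V₂}

@[simp]
theorem bridgeJoin_adj_inl_inl {x y : V₁} :
    (bridgeJoin Y₁ Y₂ a b).Adj (Sum.inl x) (Sum.inl y) ↔ Y₁.Adj x y := by
  simp [bridgeJoin, SimpleGraph.edge_adj]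

@[simp]
theorem bridgeJoin_adj_inr_inr {x y : V₂} :
    (bridgeJoin Y₁ Y₂ a b).Adj (Sum.inr x) (Sum.inr y) ↔ Y₂.Adj x y := by
  simp [bridgeJoin, SimpleGraph.edge_adj]

@[simp]
theorem bridgeJoin_adj_inl_inr {x : V₁} {y : V₂} :
    (bridgeJoin Y₁ Y₂ a b).Adj (Sum.inl x) (Sum.inr y) ↔ x = a ∧ y = b := by
  simp [bridgeJoin, SimpleGraph.edge_adj]

@[simp]
theorem bridgeJoin_adj_inr_inl {x : V₁} {y : V₂} :
    (bridgeJoin Y₁ Y₂ a b).Adj (Sum.inr y) (Sum.inl x) ↔ x = a ∧ y = b := by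
  rw [SimpleGraph.adj_comm, bridgeJoin_adj_inl_inr]

variable [Fintype V₁] [Fintype V₂]

theorem not_adj_left_of_perfectStateTransfer
    (hpst : PerfectStateTransfer (bridgeJoin Y₁ Y₂ a b) (Sum.inl a) (Sum.inr b)) (x : V₁) :
    ¬ Y₁.Adj a x := by
  classical
  obtain ⟨t, -, ht⟩ := hpst
  obtain ⟨γ, hγ, ha, hb⟩ := ht.exists_phase
  set e : EuclideanSpace ℝ V₁ := EuclideanSpace.single a 1 with he
  set T : EuclideanSpace ℝ V₁ →ₗ[ℝ] EuclideanSpace ℝ V₁ := (Y₁.adjMatrix ℝ).toEuclideanLin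
    with hT
  have hTe (i : V₁) : (T e) i = Y₁.adjMatrix ℝ i a := by
    simp [hT, he, toLpLin_apply]
  have hex (y : EuclideanSpace ℝ V₁) : ⟪e, y⟫_ℝ = y a := by
    simp [he, EuclideanSpace.inner_single_left]
  have hTs : T.IsSymmetric :=
    isSymmetric_toEuclideanLin_iff.2 (SimpleGraph.isHermitian_adjMatrix ..)
  have hTe0 : T e = 0 := by
    refine map_eq_zero_of_phases hTs (w := (Finset.univ.filter (Y₁.Adj · a)).card) (γ := γ) (t := t)
      (by simp [he]) (by rw [hex, hTe]; simp) ?_ ?_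
    · rw [PiLp.inner_apply]
      simp [hTe]
    · intro σ μ y hσ hy hTy
      rw [hex] at hy hTy
      have hcoord (i : V₁) : ∑ j, Y₁.adjMatrix ℝ i j * y j + σ * y a * (if i = a then 1 else 0) =
          μ * y i := by
        have := congrArg (fun z : EuclideanSpace ℝ V₁ ↦ z i) hTy
        simpa [hT, he, toLpLin_apply, mulVec, dotProduct, Pi.single_apply] using this
      constructor
      · obtain ⟨s, hs⟩ : ∃ s : ℤ, σ = s := by
          rcases mul_self_eq_one_iff.1 hσ with rfl | rfl
          exacts [⟨1, by simp⟩, ⟨-1, by simp⟩]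
        -- `T + σR` has an integer matrix.
        refine isIntegral_of_mulVec_eq (M := Y₁.adjMatrix ℤ + Matrix.single a a s) (v := y)
          (fun h0 ↦ hy (congrFun h0 a)) ?_
        ext i
        rw [Pi.smul_apply, smul_eq_mul, ← hcoord, mulVec, dotProduct]
        simp only [map_apply, Matrix.add_apply, map_add, add_mul, Finset.sum_add_distrib]
        congr 1
        · refine Finset.sum_congr rfl fun j _ ↦ ?_
          simp only [SimpleGraph.adjMatrix_apply]
          split_ifs <;> simp
        · rw [Finset.sum_eq_single a]
          · rcases eq_or_ne i a with rfl | hi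
            · simp [hs]
            · simp [hi, Matrix.single, hi.symm]
          · intro j _ hj
            simp [Matrix.single, hj.symm]
          · simp
      · refine exp_eq_of_mulVec_eq (SimpleGraph.transpose_adjMatrix ..) hγ ha hb
          (u := Sum.elim (fun i ↦ (y i : ℂ)) 0) (by exact_mod_cast hσ) (by simpa using hy) rfl ?_
        ext (i | i)
        · have := congrArg (fun r : ℝ ↦ (r : ℂ)) (hcoord i)
          simp only [Complex.ofReal_add, Complex.ofReal_sum, Complex.ofReal_mul,
            SimpleGraph.adjMatrix_apply, apply_ite Complex.ofReal, Complex.ofReal_one,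
            Complex.ofReal_zero] at this
          simp only [mulVec, dotProduct, Fintype.sum_sum_type, SimpleGraph.adjMatrix_apply,
            bridgeJoin_adj_inl_inl, Sum.elim_inl, Sum.elim_inr, Pi.zero_apply, mul_zero,
            Finset.sum_const_zero, add_zero, Pi.add_apply, Pi.smul_apply, Pi.sub_apply, smul_eq_mul,
            Pi.single_apply, reduceCtorEq, if_false, Sum.inl.injEq]
          rw [← this]
          split_ifs <;> ring
        · simp [mulVec, dotProduct, SimpleGraph.adjMatrix_apply, Pi.single_apply,
            ite_and, eq_comm]
  intro hax
  have := hTe x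
  rw [hTe0] at this
  simp [SimpleGraph.adjMatrix_apply, hax.symm] at this

theorem not_adj_right_of_perfectStateTransfer
    (hpst : PerfectStateTransfer (bridgeJoin Y₁ Y₂ a b) (Sum.inl a) (Sum.inr b)) (x : V₂) :
    ¬ Y₂.Adj b x := by
  classical
  have hleft := not_adj_left_of_perfectStateTransfer hpst
  obtain ⟨t, -, ht⟩ := hpst
  obtain ⟨γ, hγ, ha, hb⟩ := ht.exists_phase
  set A := (bridgeJoin Y₁ Y₂ a b).adjMatrix ℂ with hA
  set U := NormedSpace.exp ((Complex.I * t) • A) with hU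
  have hcomm : A * U = U * A := (((Commute.refl A).smul_right _).exp_right).eq
  have hAa : A *ᵥ Pi.single (Sum.inl a) 1 = Pi.single (Sum.inr b) 1 := by
    ext (i | i)
    · simp [hA, SimpleGraph.adj_comm _ i, hleft]
    · simp [hA, Pi.single_apply]
  have hAb : A *ᵥ Pi.single (Sum.inr b) 1 = Pi.single (Sum.inl a) 1 := by
    -- Apply `U` to `A e_a = e_b`, valid once `a` is isolated in `Y₁`.
    have : A *ᵥ (U *ᵥ Pi.single (Sum.inl a) 1) = U *ᵥ (A *ᵥ Pi.single (Sum.inl a) 1) := by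
      rw [mulVec_mulVec, hcomm, ← mulVec_mulVec]
    rw [hAa, ha, hb, mulVec_smul] at this
    exact smul_right_injective _ hγ this
  intro hbx
  have := congrFun hAb (Sum.inr x)
  simp [hA, hbx.symm] at this

end bridgeJoin

theorem SimpleGraph.Connected.card_eq_one_of_forall_not_adj {V : Type*} [Fintype V]
    {G : SimpleGraph V} (hG : G.Connected) {a : V} (h : ∀ x, ¬ G.Adj a x) : Fintype.card V = 1 := by
  rcases subsingleton_or_nontrivial V with hV | hV
  · exact Fintype.card_eq_one_iff.2 ⟨a, fun y ↦ Subsingleton.elim _ _⟩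
  · obtain ⟨x, hx⟩ := hG.preconnected.exists_adj_of_nontrivial a
    exact absurd hx (h x)

theorem mainTheorem1 {V₁ V₂ : Type*} [Fintype V₁] [Fintype V₂]
    (Y₁ : SimpleGraph V₁) (Y₂ : SimpleGraph V₂)
    (hY₁ : Y₁.Connected) (hY₂ : Y₂.Connected) (a : V₁) (b : V₂)
    (hpst : PerfectStateTransfer (bridgeJoin Y₁ Y₂ a b) (Sum.inl a) (Sum.inr b)) :
    Fintype.card V₁ = 1 ∧ Fintype.card V₂ = 1 ∧
      Nonempty (bridgeJoin Y₁ Y₂ a b ≃g SimpleGraph.pathGraph 2) := by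
  have h₁ := hY₁.card_eq_one_of_forall_not_adj (not_adj_left_of_perfectStateTransfer hpst)
  have h₂ := hY₂.card_eq_one_of_forall_not_adj (not_adj_right_of_perfectStateTransfer hpst)
  refine ⟨h₁, h₂, ?_⟩
  have := Fintype.card_le_one_iff_subsingleton.1 h₁.le
  have := Fintype.card_le_one_iff_subsingleton.1 h₂.le
  have htop : bridgeJoin Y₁ Y₂ a b = ⊤ := by
    ext (x | x) (y | y)
    · simp [Subsingleton.elim x y]
    · simp [Subsingleton.elim x a, Subsingleton.elim y b]
    · simp [Subsingleton.elim y a, Subsingleton.elim x b]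
    · simp [Subsingleton.elim x y]
  rw [htop, SimpleGraph.pathGraph_two_eq_top]
  exact ⟨SimpleGraph.Iso.completeGraph (Fintype.equivFinOfCardEq (by simp [h₁, h₂]))⟩
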